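/- For $X\in\mathbb R^{n\times d}$ with rows $x_1,\dots,x_n\in\mathbb R^d$ and an integer $q\ge 1$, let $\|X\|_{2\to\bar q}=\sup_{\|v\|_2=1}\bigl(\mathbb E_i|\langle x_i,v\rangle|^q\bigr)^{1/q}$, where $\mathbb E_i$ is the average over $i\in\{1,\dots,n\}$. For even $q$ let $M_q(X)=\mathbb E_i\, x_i^{\otimes q/2}(x_i^{\otimes q/2})^\top\in\mathbb R^{d^{q/2}\times d^{q/2}}$, and let $\|\cdot\|_{op}$ denote the spectral norm. (1) Let $q\ge 2$ be even, $\alpha>0$, and let $X\in\mathbb R^{n\times d}$ satisfy $\|X\|_{2\to\bar q}\le\alpha$. Then $\|M_q(X)\|_{op}\le\alpha^q\, d^{q/4}$. (2) Consequently, for every even $q\ge 2$ the number $\mathrm{ALG}(X)=\|M_q(X)\|_{op}^{1/q}$ satisfies $\|X\|_{2\to\bar q}\le \mathrm{ALG}(X)\le d^{1/4}\,\|X\|_{2\to\bar q}$ for all $X\in\mathbb R^{n\times d}$. In particular, for every $\alpha>0$, the test that answers YES if and only if $\mathrm{ALG}(X)>\alpha d^{1/4}$ answers YES on every $X\in\mathbb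 R^{n\times d}$ with $\|X\|_{2\to\bar q}>\alpha d^{1/4}$ and NO on every $X\in\mathbb R^{n\times d}$ with $\|X\|_{2\to\bar q}\le\alpha$. (3) Let $q\ge 4$ be divisible by $4$ and let $K>0$. There are constants $C,c>0$, depending only on $q$ and $K$, such that for all $n,d$ with $n\ge K d^{q/2}$ there is a matrix $X\in\mathbb R^{n\times d}$ with $\|X\|_{2\to\bar q}\le C$ and $\|M_q(X)\|_{op}\ge c\, d^{q/4}$. -/

import Mathlib

noncomputable section

/-- The expectation norm `(𝔼_i |x_i| ^ q) ^ (1 / q)` of a vector `x ∈ ℝⁿ`,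
with `i` uniform in `{1, …, n}`. -/
def expNorm {n : ℕ} (q : ℕ) (x : Fin n → ℝ) : ℝ :=
  ((∑ i, |x i| ^ q) / (n : ℝ)) ^ (1 / (q : ℝ))

/-- The norm `‖X‖_{2 → q̄}`: the supremum of the expectation norm of `X v` over all `v` that are
unit vectors for the Euclidean norm. -/
def twoToExpNorm {n d : ℕ} (q : ℕ) (X : Matrix (Fin n) (Fin d) ℝ) : ℝ :=
  ⨆ v : Metric.sphere (0 : EuclideanSpace ℝ (Fin d)) 1,
    expNorm q (X.mulVec (v : EuclideanSpace ℝ (Fin d)).ofLp)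

/-- The tensor power `x^{⊗ k}`, as a vector with coordinates indexed by `{1, …, d}^k`. -/
def tensorPow {d : ℕ} (k : ℕ) (x : Fin d → ℝ) : (Fin k → Fin d) → ℝ :=
  fun γ => ∏ r, x (γ r)

/-- The flattened moment matrix `𝔼_i x_i^{⊗ q/2} (x_i^{⊗ q/2})ᵀ`, where `x_i` are the rows of `X`
(used for even `q` only). -/
def flatMoment {n d : ℕ} (q : ℕ) (X : Matrix (Fin n) (Fin d) ℝ) :
    Matrix (Fin (q / 2) → Fin d) (Fin (q / 2) → Fin d) ℝ :=
  (n : ℝ)⁻¹ • ∑ i, Matrix.vecMulVec (tensorPow (q / 2) (X i)) (tensorPow (q / 2) (X i))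

/-- The spectral norm of a square real matrix: its operator norm on Euclidean space. -/
def specNorm {ι : Type*} [Fintype ι] [DecidableEq ι] (M : Matrix ι ι ℝ) : ℝ :=
  ‖Matrix.toEuclideanCLM (𝕜 := ℝ) M‖

/-- The value output by the baseline spectral certificate. -/
def baselineCert {n d : ℕ} (q : ℕ) (X : Matrix (Fin n) (Fin d) ℝ) : ℝ :=
  (specNorm (flatMoment q X)) ^ (1 / (q : ℝ))

/-- The test `A` (answering YES on `X` when `A X` holds) solves the `(α, β)`-approximation problem
for the `2 → q̄` norm of `n × d` matrices: it answers YES when `‖X‖_{2 → q̄} > β`, and it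
answers NO when `‖X‖_{2 → q̄} ≤ α`. -/
def SolvesApprox (n d q : ℕ) (α β : ℝ) (A : Matrix (Fin n) (Fin d) ℝ → Prop) : Prop :=
  ∀ X : Matrix (Fin n) (Fin d) ℝ,
    (β < twoToExpNorm q X → A X) ∧ (twoToExpNorm q X ≤ α → ¬ A X)

end

/-! ### Tensor powers, spectral norm and Frobenius norm. -/

open Finset Matrix

/-! Write `z_i` for the tensor power of the row `x_i`, and `M` for the flattened moment. Since
`⟨z_i, z_j⟩ = ⟨x_i, x_j⟩ ^ (q / 2)`, everything reduces to inner products of rows.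

Upper bound: `‖M‖² ≤ ‖M‖_F² = 𝔼_{i,j} ⟨x_i, x_j⟩ ^ q`. Testing the `2 → q̄` norm on `v = x_i` leaves
`𝔼_i ‖x_i‖ ^ q`, which testing on the basis vectors bounds by `α ^ q * d ^ (q / 2)`. Soundness comes
from testing `M` on `v^{⊗ q/2}`.

Tightness: testing `M` on `∑ z_j` gives `‖M‖ ≥ 𝔼_{i,j} ⟨x_i, x_j⟩ ^ (q / 2)`, which is of order at
least `d ^ (q / 4)` once all `‖x_i‖² ≥ d / 2` (`le_specNorm_flatMoment`). Such rows with bounded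
norm come from characters along the moment curve `j ↦ (j, …, j ^ k)` over `ZMod p`, `k = q / 2`: by
Parseval their `q`-th moments count coincidences of power sums, and Newton's identities leave only
permutations (`sum_norm_pow_moment_curve_le`). -/

theorem tensorPow_dotProduct {d : ℕ} (k : ℕ) (x y : Fin d → ℝ) :
    tensorPow k x ⬝ᵥ tensorPow k y = (x ⬝ᵥ y) ^ k := by
  simp only [dotProduct, tensorPow, Fintype.sum_pow, ← Finset.prod_mul_distrib]

theorem specNorm_nonneg {ι : Type*} [Fintype ι] [DecidableEq ι] (M : Matrix ι ι ℝ) :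
    0 ≤ specNorm M := norm_nonneg _

theorem dotProduct_mulVec_le_specNorm {ι : Type*} [Fintype ι] [DecidableEq ι]
    (M : Matrix ι ι ℝ) (u : ι → ℝ) : u ⬝ᵥ M *ᵥ u ≤ specNorm M * (u ⬝ᵥ u) := by
  have hu : u ⬝ᵥ u = ‖(WithLp.toLp 2 u : EuclideanSpace ℝ ι)‖ ^ 2 := by
    rw [EuclideanSpace.norm_sq_eq]
    simp [dotProduct, sq]
  have h := Matrix.inner_toEuclideanCLM M (WithLp.toLp 2 u) (WithLp.toLp 2 u)
  rw [show u ⬝ᵥ M *ᵥ u = _ from h.symm, hu]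
  calc _ ≤ ‖(WithLp.toLp 2 u : EuclideanSpace ℝ ι)‖ *
        ‖toEuclideanCLM (𝕜 := ℝ) M (WithLp.toLp 2 u)‖ := real_inner_le_norm _ _
    _ ≤ ‖(WithLp.toLp 2 u : EuclideanSpace ℝ ι)‖ *
        (‖toEuclideanCLM (𝕜 := ℝ) M‖ * ‖(WithLp.toLp 2 u : EuclideanSpace ℝ ι)‖) := by
      gcongr
      exact ContinuousLinearMap.le_opNorm _ _
    _ = _ := by rw [specNorm]; ring

/-- The spectral norm is at most the Frobenius norm. -/
theorem specNorm_sq_le_sum_sq {ι : Type*} [Fintype ι] [DecidableEq ι] (M : Matrix ι ι ℝ) :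
    specNorm M ^ 2 ≤ ∑ a, ∑ b, M a b ^ 2 := by
  have h0 : 0 ≤ ∑ a, ∑ b, M a b ^ 2 := by positivity
  suffices h : specNorm M ≤ √(∑ a, ∑ b, M a b ^ 2) by
    calc specNorm M ^ 2 ≤ √(∑ a, ∑ b, M a b ^ 2) ^ 2 :=
          pow_le_pow_left₀ (specNorm_nonneg M) h 2
      _ = _ := Real.sq_sqrt h0
  refine ContinuousLinearMap.opNorm_le_bound _ (Real.sqrt_nonneg _) fun x => ?_
  refine le_of_sq_le_sq ?_ (by positivity)
  rw [mul_pow, Real.sq_sqrt h0, EuclideanSpace.norm_sq_eq, EuclideanSpace.norm_sq_eq,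
    Finset.sum_mul]
  refine Finset.sum_le_sum fun a _ => ?_
  simp only [Matrix.ofLp_toEuclideanCLM, Real.norm_eq_abs, sq_abs, mulVec, dotProduct]
  exact Finset.sum_mul_sq_le_sq_mul_sq _ _ _

/-- `Z Zᵀ` and `Zᵀ Z` have the same Frobenius norm: both sides expand to one fourfold sum. -/
theorem sum_sq_dotProduct_eq_sum_sq_sum_mul {ι κ : Type*} [Fintype ι] [Fintype κ]
    (Z : ι → κ → ℝ) :
    ∑ i, ∑ j, (Z i ⬝ᵥ Z j) ^ 2 = ∑ a, ∑ b, (∑ i, Z i a * Z i b) ^ 2 := by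
  have hl (i j : ι) : (Z i ⬝ᵥ Z j) ^ 2 = ∑ a, ∑ b, Z i a * Z j a * (Z i b * Z j b) := by
    rw [sq, dotProduct, Finset.sum_mul_sum]
  have hr (a b : κ) : (∑ i, Z i a * Z i b) ^ 2 = ∑ i, ∑ j, Z i a * Z j a * (Z i b * Z j b) := by
    rw [sq, Finset.sum_mul_sum]
    exact sum_congr rfl fun i _ => sum_congr rfl fun j _ => by ring
  simp only [hl, hr]
  calc _ = ∑ t : ι × ι, ∑ c : κ × κ, Z t.1 c.1 * Z t.2 c.1 * (Z t.1 c.2 * Z t.2 c.2) := by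
        simp only [Fintype.sum_prod_type]
    _ = ∑ c : κ × κ, ∑ t : ι × ι, Z t.1 c.1 * Z t.2 c.1 * (Z t.1 c.2 * Z t.2 c.2) :=
        Finset.sum_comm
    _ = _ := by simp only [Fintype.sum_prod_type]

/-! ### Quadratic form and Frobenius norm of the flattened moment. -/

section Moment

variable {n d : ℕ} (q : ℕ) (X : Matrix (Fin n) (Fin d) ℝ)

theorem flatMoment_apply (a b : Fin (q / 2) → Fin d) :
    flatMoment q X a b =
      (n : ℝ)⁻¹ * ∑ i, tensorPow (q / 2) (X i) a * tensorPow (q / 2) (X i) b := by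
  simp [flatMoment, Matrix.sum_apply, vecMulVec_apply]

theorem dotProduct_flatMoment_mulVec (u : (Fin (q / 2) → Fin d) → ℝ) :
    u ⬝ᵥ flatMoment q X *ᵥ u =
      (n : ℝ)⁻¹ * ∑ i, (tensorPow (q / 2) (X i) ⬝ᵥ u) ^ 2 := by
  have h (i : Fin n) : u ⬝ᵥ vecMulVec (tensorPow (q / 2) (X i)) (tensorPow (q / 2) (X i)) *ᵥ u =
      (tensorPow (q / 2) (X i) ⬝ᵥ u) ^ 2 := by
    rw [vecMulVec_mulVec, dotProduct_smul, dotProduct_comm u]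
    simp [sq]
  simp only [flatMoment, smul_mulVec, sum_mulVec, dotProduct_smul, dotProduct_sum, h, smul_eq_mul]

theorem sum_sq_flatMoment :
    ∑ a, ∑ b, flatMoment q X a b ^ 2 =
      (n : ℝ)⁻¹ ^ 2 * ∑ i, ∑ j, (X i ⬝ᵥ X j) ^ (2 * (q / 2)) := by
  have h (i j : Fin n) : (X i ⬝ᵥ X j) ^ (2 * (q / 2)) =
      (tensorPow (q / 2) (X i) ⬝ᵥ tensorPow (q / 2) (X j)) ^ 2 := by
    rw [tensorPow_dotProduct, ← pow_mul, mul_comm]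
  simp only [flatMoment_apply, h, mul_pow, ← Finset.mul_sum,
    sum_sq_dotProduct_eq_sum_sq_sum_mul]

end Moment

/-! ### Soundness and approximation factor of the certificate. -/

section Norm

variable {n d q : ℕ}

theorem expNorm_nonneg (x : Fin n → ℝ) : 0 ≤ expNorm q x := by
  unfold expNorm
  positivity

theorem expNorm_pow (hq : q ≠ 0) (x : Fin n → ℝ) :
    expNorm q x ^ q = (∑ i, |x i| ^ q) / n := by
  rw [expNorm, one_div, Real.rpow_inv_natCast_pow (by positivity) hq]

theorem baselineCert_nonneg (X : Matrix (Fin n) (Fin d) ℝ) : 0 ≤ baselineCert q X :=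
  Real.rpow_nonneg (specNorm_nonneg _) _

theorem baselineCert_pow (hq : q ≠ 0) (X : Matrix (Fin n) (Fin d) ℝ) :
    baselineCert q X ^ q = specNorm (flatMoment q X) := by
  rw [baselineCert, one_div, Real.rpow_inv_natCast_pow (specNorm_nonneg _) hq]

theorem twoToExpNorm_nonneg (X : Matrix (Fin n) (Fin d) ℝ) : 0 ≤ twoToExpNorm q X :=
  Real.iSup_nonneg fun _ => expNorm_nonneg _

theorem dotProduct_ofLp_self (v : EuclideanSpace ℝ (Fin d)) : v.ofLp ⬝ᵥ v.ofLp = ‖v‖ ^ 2 := by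
  rw [EuclideanSpace.norm_sq_eq]
  simp [dotProduct, sq]

/-- The test vector is the tensor power of `v`, again a unit vector. The bound also shows that the
supremum defining `twoToExpNorm` is over a bounded set. -/
theorem expNorm_mulVec_le_baselineCert (hq : q ≠ 0) (hev : Even q) (X : Matrix (Fin n) (Fin d) ℝ)
    (v : Metric.sphere (0 : EuclideanSpace ℝ (Fin d)) 1) :
    expNorm q (X.mulVec (v : EuclideanSpace ℝ (Fin d)).ofLp) ≤ baselineCert q X := by
  refine le_of_pow_le_pow_left₀ hq (baselineCert_nonneg X) ?_
  rw [expNorm_pow hq, baselineCert_pow hq]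
  set w := (v : EuclideanSpace ℝ (Fin d)).ofLp with hw
  have hv : w ⬝ᵥ w = 1 := by
    rw [hw, dotProduct_ofLp_self, norm_eq_of_mem_sphere, one_pow]
  have h := dotProduct_mulVec_le_specNorm (flatMoment q X) (tensorPow (q / 2) w)
  rw [tensorPow_dotProduct, hv, one_pow, mul_one, dotProduct_flatMoment_mulVec] at h
  refine le_trans (le_of_eq ?_) h
  rw [div_eq_inv_mul]
  congr 1
  refine sum_congr rfl fun i _ => ?_
  rw [tensorPow_dotProduct, ← pow_mul, Nat.div_mul_cancel hev.two_dvd, hev.pow_abs]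
  rfl

theorem twoToExpNorm_le_baselineCert (hq : q ≠ 0) (hev : Even q) (X : Matrix (Fin n) (Fin d) ℝ) :
    twoToExpNorm q X ≤ baselineCert q X :=
  Real.iSup_le (expNorm_mulVec_le_baselineCert hq hev X) (baselineCert_nonneg X)

theorem expNorm_mulVec_le_twoToExpNorm (hq : q ≠ 0) (hev : Even q) (X : Matrix (Fin n) (Fin d) ℝ)
    (v : Metric.sphere (0 : EuclideanSpace ℝ (Fin d)) 1) :
    expNorm q (X.mulVec (v : EuclideanSpace ℝ (Fin d)).ofLp) ≤ twoToExpNorm q X :=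
  le_ciSup (f := fun v : Metric.sphere (0 : EuclideanSpace ℝ (Fin d)) 1 =>
      expNorm q (X.mulVec (v : EuclideanSpace ℝ (Fin d)).ofLp))
    ⟨baselineCert q X, by
      rintro _ ⟨v, rfl⟩
      exact expNorm_mulVec_le_baselineCert hq hev X v⟩ v

/-- Homogeneous form of the norm bound, so that rows of `X` can be tested without normalization. -/
theorem sum_dotProduct_pow_le (hq : q ≠ 0) (hev : Even q) (X : Matrix (Fin n) (Fin d) ℝ)
    (v : Fin d → ℝ) :
    ∑ i, (X i ⬝ᵥ v) ^ q ≤ n * twoToExpNorm q X ^ q * (v ⬝ᵥ v) ^ (q / 2) := by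
  rcases Nat.eq_zero_or_pos n with rfl | hn
  · simp
  rcases eq_or_ne v 0 with rfl | hv
  · simp only [dotProduct_zero, zero_pow hq, sum_const_zero]
    exact mul_nonneg (mul_nonneg n.cast_nonneg (pow_nonneg (twoToExpNorm_nonneg X) q))
      (pow_nonneg le_rfl _)
  set w : EuclideanSpace ℝ (Fin d) := WithLp.toLp 2 v with hw
  have hw0 : w ≠ 0 := fun h => hv (congrArg WithLp.ofLp h)
  have hpos : 0 < ‖w‖ := norm_pos_iff.mpr hw0
  have hu : ‖w‖⁻¹ • w ∈ Metric.sphere (0 : EuclideanSpace ℝ (Fin d)) 1 := by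
    simp [norm_smul, hpos.ne']
  have h := pow_le_pow_left₀ (expNorm_nonneg _)
    (expNorm_mulVec_le_twoToExpNorm hq hev X ⟨_, hu⟩) q
  have hi (i : Fin n) : |(X *ᵥ (‖w‖⁻¹ • w).ofLp) i| ^ q = ‖w‖⁻¹ ^ q * (X i ⬝ᵥ v) ^ q := by
    rw [hev.pow_abs, WithLp.ofLp_smul, mulVec_smul, ← mul_pow]
    rfl
  rw [expNorm_pow hq] at h
  simp only [hi, ← Finset.mul_sum] at h
  rw [div_le_iff₀ (by positivity), inv_pow, inv_mul_le_iff₀ (by positivity)] at h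
  have hvv : (v ⬝ᵥ v) ^ (q / 2) = ‖w‖ ^ q := by
    rw [show v ⬝ᵥ v = ‖w‖ ^ 2 from dotProduct_ofLp_self w, ← pow_mul,
      Nat.mul_div_cancel' hev.two_dvd]
  rw [hvv]
  linarith

theorem twoToExpNorm_le_of_sum_dotProduct_pow_le (hq : q ≠ 0) (hev : Even q)
    (X : Matrix (Fin n) (Fin d) ℝ) {B : ℝ} (hB : 0 ≤ B)
    (h : ∀ v : Fin d → ℝ, ∑ i, (X i ⬝ᵥ v) ^ q ≤ n * B ^ q * (v ⬝ᵥ v) ^ (q / 2)) :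
    twoToExpNorm q X ≤ B := by
  refine Real.iSup_le (fun v => ?_) hB
  refine le_of_pow_le_pow_left₀ hq hB ?_
  rw [expNorm_pow hq]
  have hv := h (v : EuclideanSpace ℝ (Fin d)).ofLp
  rw [dotProduct_ofLp_self, norm_eq_of_mem_sphere, one_pow, one_pow, mul_one] at hv
  refine div_le_of_le_mul₀ (by positivity) (by positivity) ?_
  rw [mul_comm]
  refine le_trans (le_of_eq (sum_congr rfl fun i _ => ?_)) hv
  rw [hev.pow_abs]
  rfl

/-- The power mean inequality over the `d` coordinates reduces to columns, which are controlled by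
testing on basis vectors. -/
theorem sum_dotProduct_self_pow_le (hq : q ≠ 0) (hev : Even q) (X : Matrix (Fin n) (Fin d) ℝ) :
    ∑ i, (X i ⬝ᵥ X i) ^ (q / 2) ≤ n * twoToExpNorm q X ^ q * (d : ℝ) ^ (q / 2) := by
  obtain ⟨m, hm⟩ : ∃ m, q / 2 = m + 1 :=
    Nat.exists_eq_succ_of_ne_zero (by have := Nat.le_of_dvd (by omega) hev.two_dvd; omega)
  have hrow (i : Fin n) : (X i ⬝ᵥ X i) ^ (q / 2) ≤ (d : ℝ) ^ m * ∑ a, X i a ^ q := by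
    have h := pow_sum_le_card_mul_sum_pow (s := univ) (f := fun a => X i a ^ 2)
      (fun a _ => sq_nonneg _) m
    simp only [← pow_mul, card_univ, Fintype.card_fin] at h
    rw [← hm, Nat.mul_div_cancel' hev.two_dvd] at h
    simpa [dotProduct, ← sq] using h
  have hcol (a : Fin d) : ∑ i, X i a ^ q ≤ n * twoToExpNorm q X ^ q := by
    simpa using sum_dotProduct_pow_le hq hev X (Pi.single a 1)
  calc ∑ i, (X i ⬝ᵥ X i) ^ (q / 2) ≤ ∑ i, (d : ℝ) ^ m * ∑ a, X i a ^ q :=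
        sum_le_sum fun i _ => hrow i
    _ = (d : ℝ) ^ m * ∑ a, ∑ i, X i a ^ q := by rw [← Finset.mul_sum, Finset.sum_comm]
    _ ≤ (d : ℝ) ^ m * ∑ _a : Fin d, n * twoToExpNorm q X ^ q := by
      gcongr
      exact hcol _
    _ = _ := by
      rw [hm, sum_const, card_univ, Fintype.card_fin, nsmul_eq_mul]
      ring

theorem specNorm_flatMoment_le (hq : q ≠ 0) (hev : Even q) (X : Matrix (Fin n) (Fin d) ℝ) :
    specNorm (flatMoment q X) ≤ twoToExpNorm q X ^ q * (d : ℝ) ^ ((q : ℝ) / 4) := by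
  have hT := twoToExpNorm_nonneg (q := q) X
  have hd : ((d : ℝ) ^ ((q : ℝ) / 4)) ^ 2 = (d : ℝ) ^ (q / 2) := by
    rw [← Real.rpow_natCast, ← Real.rpow_mul (by positivity), ← Real.rpow_natCast,
      Nat.cast_div hev.two_dvd (by norm_num)]
    congr 1
    push_cast
    ring
  refine le_of_sq_le_sq ?_ (by positivity)
  rw [mul_pow, hd]
  refine (specNorm_sq_le_sum_sq _).trans ?_
  rw [sum_sq_flatMoment, Nat.mul_div_cancel' hev.two_dvd]
  -- Only an inequality, because `n = 0` is allowed and then `n⁻¹ = 0`.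
  have hn : (n : ℝ)⁻¹ ^ 2 * (n : ℝ) ^ 2 ≤ 1 := by
    rw [← mul_pow]
    exact pow_le_one₀ (by positivity) (inv_mul_le_one)
  calc (n : ℝ)⁻¹ ^ 2 * ∑ i, ∑ j, (X i ⬝ᵥ X j) ^ q
      ≤ (n : ℝ)⁻¹ ^ 2 * ∑ i, n * twoToExpNorm q X ^ q * (X i ⬝ᵥ X i) ^ (q / 2) := by
        gcongr with i _
        refine le_trans (le_of_eq (sum_congr rfl fun j _ => ?_))
          (sum_dotProduct_pow_le hq hev X (X i))
        rw [dotProduct_comm]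
    _ ≤ (n : ℝ)⁻¹ ^ 2 * (n * twoToExpNorm q X ^ q *
          (n * twoToExpNorm q X ^ q * (d : ℝ) ^ (q / 2))) := by
        rw [← Finset.mul_sum]
        gcongr
        exact sum_dotProduct_self_pow_le hq hev X
    _ = ((n : ℝ)⁻¹ ^ 2 * (n : ℝ) ^ 2) * ((twoToExpNorm q X ^ q) ^ 2 * (d : ℝ) ^ (q / 2)) := by ring
    _ ≤ 1 * ((twoToExpNorm q X ^ q) ^ 2 * (d : ℝ) ^ (q / 2)) := by gcongr
    _ = _ := one_mul _

theorem baselineCert_le (hq : q ≠ 0) (hev : Even q) (X : Matrix (Fin n) (Fin d) ℝ) :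
    baselineCert q X ≤ (d : ℝ) ^ ((1 : ℝ) / 4) * twoToExpNorm q X := by
  have hT := twoToExpNorm_nonneg (q := q) X
  refine le_of_pow_le_pow_left₀ hq (by positivity) ?_
  rw [baselineCert_pow hq, mul_pow, ← Real.rpow_mul_natCast (by positivity), mul_comm]
  refine (specNorm_flatMoment_le hq hev X).trans (le_of_eq ?_)
  congr 2
  ring

/-! ### Lower bounds on the spectral norm. -/

/-- Averaging the tensor powers of the rows gives a test vector for the flattened moment. -/
theorem sum_dotProduct_pow_le_specNorm (X : Matrix (Fin n) (Fin d) ℝ) :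
    ∑ i, ∑ j, (X i ⬝ᵥ X j) ^ (q / 2) ≤ specNorm (flatMoment q X) * (n : ℝ) ^ 2 := by
  set u : (Fin (q / 2) → Fin d) → ℝ := ∑ j, tensorPow (q / 2) (X j) with hu
  set B := u ⬝ᵥ u with hB
  have hBsum : ∑ i, ∑ j, (X i ⬝ᵥ X j) ^ (q / 2) = B := by
    simp only [hB, hu, sum_dotProduct, dotProduct_sum, tensorPow_dotProduct]
    exact Finset.sum_comm
  have hB' : ∑ i, tensorPow (q / 2) (X i) ⬝ᵥ u = B := by rw [hB, ← sum_dotProduct]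
  have hS := specNorm_nonneg (flatMoment q X)
  rw [hBsum]
  rcases Nat.eq_zero_or_pos n with rfl | hn
  · simp [hB, hu]
  rcases le_or_gt B 0 with h0 | h0
  · exact h0.trans (by positivity)
  have h1 := dotProduct_mulVec_le_specNorm (flatMoment q X) u
  rw [dotProduct_flatMoment_mulVec, inv_mul_le_iff₀ (by positivity)] at h1
  -- The inner products with `u` sum to `B`, so Cauchy–Schwarz gives `B² ≤ n² * specNorm * B`.
  have h2 := sq_sum_le_card_mul_sum_sq (s := univ) (f := fun i => tensorPow (q / 2) (X i) ⬝ᵥ u)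
  rw [hB', card_univ, Fintype.card_fin] at h2
  refine le_of_mul_le_mul_right ?_ h0
  calc B * B = B ^ 2 := (sq B).symm
    _ ≤ n * ∑ i, (tensorPow (q / 2) (X i) ⬝ᵥ u) ^ 2 := h2
    _ ≤ n * (n * (specNorm (flatMoment q X) * B)) := by gcongr
    _ = _ := by ring

/-- The Gram matrix of `n` vectors in dimension `d` has large Frobenius norm. -/
theorem sq_sum_dotProduct_self_le (X : Matrix (Fin n) (Fin d) ℝ) :
    (∑ i, X i ⬝ᵥ X i) ^ 2 ≤ d * ∑ i, ∑ j, (X i ⬝ᵥ X j) ^ 2 := by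
  rw [sum_sq_dotProduct_eq_sum_sq_sum_mul fun i => X i]
  -- Cauchy–Schwarz on the `d` diagonal entries of `Xᵀ X`; the off-diagonal ones are dropped.
  have h := sq_sum_le_card_mul_sum_sq (s := univ) (f := fun a => ∑ i, X i a * X i a)
  rw [Finset.sum_comm, card_univ, Fintype.card_fin] at h
  refine h.trans ?_
  gcongr with a _
  exact single_le_sum (f := fun b => (∑ i, X i a * X i b) ^ 2) (fun b _ => sq_nonneg _) (mem_univ a)

/-- As `4 ∣ q`, the exponent `q / 2 = 2 * m` is even, so the power mean inequality applies to the
squares `⟨x_i, x_j⟩²`, whose average is at least `(d / 2)² / d = d / 4`. -/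
theorem le_specNorm_flatMoment {m : ℕ} (hq : q = 4 * m) (hm : m ≠ 0) (hn : n ≠ 0) (hd : d ≠ 0)
    (X : Matrix (Fin n) (Fin d) ℝ) (hX : ∀ i, (d : ℝ) / 2 ≤ X i ⬝ᵥ X i) :
    ((d : ℝ) / 4) ^ m ≤ specNorm (flatMoment q X) := by
  have hn' : 0 < (n : ℝ) := by positivity
  have hd' : 0 < (d : ℝ) := by positivity
  obtain ⟨l, rfl⟩ := Nat.exists_eq_succ_of_ne_zero hm
  have h1 : (n : ℝ) ^ 2 * (d / 4) ≤ ∑ i, ∑ j, (X i ⬝ᵥ X j) ^ 2 := by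
    have h := sq_sum_dotProduct_self_le X
    have h' : (n : ℝ) * (d / 2) ≤ ∑ i, X i ⬝ᵥ X i := by
      have := card_nsmul_le_sum univ (fun i => X i ⬝ᵥ X i) _ fun i _ => hX i
      simpa using this
    have h'' := (pow_le_pow_left₀ (by positivity) h' 2).trans h
    refine le_of_mul_le_mul_left (le_trans (le_of_eq ?_) h'') hd'
    ring
  have h2 := sum_dotProduct_pow_le_specNorm (q := q) X
  have hq2 : q / 2 = 2 * (l + 1) := by omega
  have h3 := pow_sum_le_card_mul_sum_pow (s := (univ : Finset (Fin n × Fin n)))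
      (f := fun t => (X t.1 ⬝ᵥ X t.2) ^ 2) (fun t _ => sq_nonneg _) l
  simp only [Fintype.sum_prod_type, ← pow_mul, ← hq2, card_univ, Fintype.card_prod,
    Fintype.card_fin, Nat.cast_mul] at h3
  have h4 := (pow_le_pow_left₀ (by positivity) h1 (l + 1)).trans h3
  have h5 : ((n : ℝ) ^ 2) ^ (l + 1) * (d / 4) ^ (l + 1) ≤
      ((n : ℝ) ^ 2) ^ (l + 1) * specNorm (flatMoment q X) := by
    calc _ = ((n : ℝ) ^ 2 * (d / 4)) ^ (l + 1) := (mul_pow _ _ _).symm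
      _ ≤ _ := h4
      _ ≤ ((n : ℝ) * n) ^ l * (specNorm (flatMoment q X) * (n : ℝ) ^ 2) := by gcongr
      _ = _ := by ring
  exact le_of_mul_le_mul_left h5 (by positivity)

end Norm

/-! ### Power sums determine a multiset. -/

section Newton

variable {F : Type*} [Field F] {k : ℕ}

/-- Over a field in which `1, …, k` are invertible, the power sums of degree `1, …, k` determine
a family of `k` elements up to order. -/
theorem map_univ_eq_of_sum_pow_eq (hk : ∀ r : ℕ, 0 < r → r ≤ k → (r : F) ≠ 0) {f g : Fin k → F}
    (h : ∀ r, 0 < r → r ≤ k → ∑ i, f i ^ r = ∑ i, g i ^ r) :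
    univ.val.map f = univ.val.map g := by
  have hE : ∀ r ≤ k, MvPolynomial.aeval f (MvPolynomial.esymm (Fin k) F r) =
      MvPolynomial.aeval g (MvPolynomial.esymm (Fin k) F r) := by
    intro r
    induction r using Nat.strong_induction_on with
    | _ r ih =>
    intro hr
    rcases Nat.eq_zero_or_pos r with rfl | hpos
    · simp [MvPolynomial.esymm_zero]
    -- Newton's identity expresses `r * e_r` through `e_i` with `i < r` and power sums of degree `1,
    -- …, r`.
    have N := MvPolynomial.mul_esymm_eq_sum (Fin k) F r
    have Nf := congrArg (MvPolynomial.aeval f) N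
    have Ng := congrArg (MvPolynomial.aeval g) N
    simp only [map_mul, map_natCast, map_pow, map_neg, map_one, map_sum] at Nf Ng
    refine mul_left_cancel₀ (hk r hpos hr) ?_
    rw [Nf, Ng]
    congr 1
    refine sum_congr rfl fun a ha => ?_
    simp only [mem_filter, HasAntidiagonal.mem_antidiagonal] at ha
    rw [ih a.1 ha.2 (by omega)]
    congr 1
    simpa [MvPolynomial.psum] using h a.2 (by omega) (by omega)
  have hP : ((univ.val.map f).map fun t => Polynomial.X - Polynomial.C t).prod =
      ((univ.val.map g).map fun t => Polynomial.X - Polynomial.C t).prod := by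
    rw [Multiset.prod_X_sub_X_eq_sum_esymm, Multiset.prod_X_sub_X_eq_sum_esymm]
    simp only [Multiset.card_map]
    refine sum_congr rfl fun r hr => ?_
    have := hE r (by simpa [Nat.lt_succ_iff] using hr)
    simp only [MvPolynomial.aeval_esymm_eq_multiset_esymm] at this
    rw [this]
  simpa only [Polynomial.roots_multiset_prod_X_sub_C] using congrArg Polynomial.roots hP

end Newton

/-! ### Character sums along the moment curve. -/

section Characters

open ZMod

theorem addChar_map_sum {A M ι : Type*} [AddCommMonoid A] [CommMonoid M] (ψ : AddChar A M)
    (s : Finset ι) (f : ι → A) : ψ (∑ i ∈ s, f i) = ∏ i ∈ s, ψ (f i) := by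
  classical
  induction s using Finset.induction_on with
  | empty => simp
  | insert i s hi ih => rw [sum_insert hi, prod_insert hi, AddChar.map_add_eq_mul, ih]

variable {p k : ℕ} [Fact p.Prime]

theorem sum_stdAddChar_dotProduct (b : Fin k → ZMod p) :
    ∑ a : Fin k → ZMod p, stdAddChar (a ⬝ᵥ b) = if b = 0 then (p : ℂ) ^ k else 0 := by
  have h (a : Fin k → ZMod p) : stdAddChar (a ⬝ᵥ b) = ∏ s, stdAddChar (a s * b s) := by
    rw [dotProduct, addChar_map_sum]
  simp only [h]
  rw [← Fintype.piFinset_univ, ← Finset.prod_univ_sum (fun _ => univ)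
    (fun s (x : ZMod p) => stdAddChar (x * b s))]
  simp only [AddChar.sum_mulShift _ (isPrimitive_stdAddChar p), ZMod.card]
  split_ifs with hb
  · simp [hb]
  · obtain ⟨s, hs⟩ := Function.ne_iff.mp hb
    exact Finset.prod_eq_zero (mem_univ s) (by rw [if_neg (by simpa using hs), Nat.cast_zero])

/-- Parseval's identity for a character sum whose frequencies `P j` may repeat. -/
theorem sum_norm_sq_character_sum {J : Type*} [Fintype J] (P : J → Fin k → ZMod p) (V : J → ℝ) :
    ∑ a : Fin k → ZMod p, ‖∑ j, (V j : ℂ) * stdAddChar (a ⬝ᵥ P j)‖ ^ 2 =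
      (p : ℝ) ^ k * ∑ j, ∑ l, if P j = P l then V j * V l else 0 := by
  have hc (x : ZMod p) : (starRingEnd ℂ) (stdAddChar x) = stdAddChar (-x) := by
    rw [AddChar.map_neg_eq_conj]
  apply Complex.ofReal_injective
  push_cast
  simp only [← Complex.mul_conj', map_sum, map_mul, Complex.conj_ofReal, hc, Finset.sum_mul_sum]
  rw [Finset.sum_comm, Finset.mul_sum]
  refine sum_congr rfl fun j _ => ?_
  rw [Finset.sum_comm, Finset.mul_sum]
  refine sum_congr rfl fun l _ => ?_
  have h (a : Fin k → ZMod p) : (V j : ℂ) * stdAddChar (a ⬝ᵥ P j) *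
      (V l * stdAddChar (-(a ⬝ᵥ P l))) = V j * V l * stdAddChar (a ⬝ᵥ (P j - P l)) := by
    rw [dotProduct_sub, sub_eq_add_neg, AddChar.map_add_eq_mul]
    ring
  simp only [h, ← Finset.mul_sum, sum_stdAddChar_dotProduct, sub_eq_zero]
  split_ifs <;> push_cast <;> ring

/-- The moment curve over `ZMod p`, read as frequencies of a character: the `2k`-th moments of
`j ↦ ψ(∑ s, a s * j ^ (s + 1))`, for uniform `a`, are bounded independently of the dimension. -/
theorem sum_norm_pow_moment_curve_le {d : ℕ} (hd : d ≤ p) (hkp : k < p) (v : Fin d → ℝ) :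
    ∑ a : Fin k → ZMod p,
        ‖∑ j, (v j : ℂ) * stdAddChar (a ⬝ᵥ fun s => (j : ZMod p) ^ (s.val + 1))‖ ^ (2 * k) ≤
      (p : ℝ) ^ k * ((k : ℝ) ^ k * (∑ j, v j ^ 2) ^ k) := by
  let P : (Fin k → Fin d) → Fin k → ZMod p := fun γ s => ∑ r, ((γ r : ℕ) : ZMod p) ^ (s.val + 1)
  let V : (Fin k → Fin d) → ℝ := fun γ => ∏ r, v (γ r)
  have hinj : Function.Injective fun j : Fin d => ((j : ℕ) : ZMod p) := by
    intro i j hij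
    have := (ZMod.natCast_eq_natCast_iff' _ _ _).mp hij
    rw [Nat.mod_eq_of_lt (by omega), Nat.mod_eq_of_lt (by omega)] at this
    exact Fin.ext this
  have hmul {γ δ : Fin k → Fin d} (h : P γ = P δ) : univ.val.map γ = univ.val.map δ := by
    have := map_univ_eq_of_sum_pow_eq (F := ZMod p) (k := k) (f := fun r => ((γ r : ℕ) : ZMod p))
      (g := fun r => ((δ r : ℕ) : ZMod p)) ?_ ?_
    · refine Multiset.map_injective hinj ?_
      simpa only [Multiset.map_map, Function.comp_def] using this
    · intro r h0 hr hz
      rw [ZMod.natCast_eq_zero_iff] at hz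
      exact absurd (Nat.le_of_dvd h0 hz) (by omega)
    · intro r h0 hr
      have := congrFun h ⟨r - 1, by omega⟩
      simpa [P, Nat.sub_add_cancel h0] using this
  have hV {γ δ : Fin k → Fin d} (h : P γ = P δ) : V γ = V δ := by
    have := congrArg (fun m => (m.map v).prod) (hmul h)
    simpa only [Multiset.map_map] using! this
  -- A rearrangement `δ` of `γ` takes only values of `γ`, so `δ = γ ∘ φ` for one of the `k ^ k` maps
  -- `φ`.
  have hcard (γ : Fin k → Fin d) : (#{δ | P γ = P δ} : ℝ) ≤ (k : ℝ) ^ k := by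
    have hsub : ({δ | P γ = P δ} : Finset (Fin k → Fin d)) ⊆
        (univ : Finset (Fin k → Fin k)).image fun φ => γ ∘ φ := by
      intro δ hδ
      have hδ := hmul (mem_filter.mp hδ).2
      have hex (r : Fin k) : ∃ s, γ s = δ r := by
        have : δ r ∈ univ.val.map γ := by
          rw [hδ]
          exact Multiset.mem_map_of_mem _ (mem_univ r)
        simpa using this
      choose φ hφ using hex
      exact mem_image.mpr ⟨φ, mem_univ _, funext hφ⟩
    have := (card_le_card hsub).trans card_image_le
    rw [card_univ, Fintype.card_fun, Fintype.card_fin] at this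
    exact_mod_cast this
  -- Expanding the `k`-th power turns the `2k`-th moment into a second moment with frequencies `P
  -- γ`, ready for Parseval.
  have hpow (a : Fin k → ZMod p) :
      ‖∑ j, (v j : ℂ) * stdAddChar (a ⬝ᵥ fun s => ((j : ℕ) : ZMod p) ^ (s.val + 1))‖ ^ (2 * k) =
        ‖∑ γ, (V γ : ℂ) * stdAddChar (a ⬝ᵥ P γ)‖ ^ 2 := by
    rw [mul_comm 2, pow_mul, ← norm_pow, Fintype.sum_pow]
    congr 2
    refine sum_congr rfl fun γ _ => ?_
    rw [prod_mul_distrib, ← addChar_map_sum, ← dotProduct_sum]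
    simp only [V, Complex.ofReal_prod]
    congr 3
    ext s
    simp [P]
  simp only [hpow]
  rw [sum_norm_sq_character_sum]
  gcongr
  calc ∑ γ, ∑ δ, (if P γ = P δ then V γ * V δ else 0)
      = ∑ γ, V γ ^ 2 * #{δ | P γ = P δ} := by
        refine sum_congr rfl fun γ _ => ?_
        rw [← sum_filter, mul_comm, ← nsmul_eq_mul, ← sum_const]
        refine sum_congr rfl fun δ hδ => ?_
        rw [← hV (mem_filter.mp hδ).2, sq]
    _ ≤ ∑ γ, V γ ^ 2 * (k : ℝ) ^ k := by
        gcongr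
        exact hcard _
    _ = (k : ℝ) ^ k * (∑ j, v j ^ 2) ^ k := by
        rw [← sum_mul, mul_comm, Fintype.sum_pow]
        simp only [V, prod_pow]

end Characters

/-! ### The extremal matrix. -/

section Construction

open ZMod

theorem exists_rows_bounded_moment (k : ℕ) {d : ℕ} (hd : d ≠ 0) :
    ∃ N : ℕ, 0 < N ∧ (N : ℝ) ≤ (2 * (k + 1)) ^ k * (d : ℝ) ^ k ∧
      ∃ y : Fin N → Fin d → ℝ, (∀ i, (d : ℝ) / 2 ≤ y i ⬝ᵥ y i) ∧
        ∀ v : Fin d → ℝ, ∑ i, (y i ⬝ᵥ v) ^ (2 * k) ≤ N * ((k : ℝ) ^ k * (v ⬝ᵥ v) ^ k) := by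
  -- Bertrand's postulate: `p > d + k` keeps the points `j` distinct and `1, …, k` invertible, while
  -- `p ≤ 2 * (d + k)` keeps the number `p ^ k` of rows of order `d ^ k`.
  obtain ⟨p, hp, hlt, hle⟩ := Nat.exists_prime_lt_and_le_two_mul (d + k) (by omega)
  have : Fact p.Prime := ⟨hp⟩
  let z : (Fin k → ZMod p) → Fin d → ℂ := fun a j =>
    stdAddChar (a ⬝ᵥ fun s => ((j : ℕ) : ZMod p) ^ (s.val + 1))
  have hz (a : Fin k → ZMod p) (j : Fin d) : (z a j).re ^ 2 + (z a j).im ^ 2 = 1 := by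
    have h : ‖z a j‖ = 1 := AddChar.norm_apply _ _
    have h2 := Complex.normSq_eq_norm_sq (z a j)
    rw [h, Complex.normSq_apply] at h2
    linarith
  -- the larger of the real and the imaginary part carries at least half of the squared norm
  have hy (a : Fin k → ZMod p) : ∃ y : Fin d → ℝ, (d : ℝ) / 2 ≤ y ⬝ᵥ y ∧
      ∀ v : Fin d → ℝ, |y ⬝ᵥ v| ≤ ‖∑ j, (v j : ℂ) * z a j‖ := by
    have hsum : (fun j => (z a j).re) ⬝ᵥ (fun j => (z a j).re) +
        (fun j => (z a j).im) ⬝ᵥ (fun j => (z a j).im) = d := by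
      simp only [dotProduct, ← sum_add_distrib, ← sq, hz]
      simp
    rcases le_total ((fun j => (z a j).re) ⬝ᵥ (fun j => (z a j).re))
      ((fun j => (z a j).im) ⬝ᵥ (fun j => (z a j).im)) with h | h
    · refine ⟨fun j => (z a j).im, by linarith, fun v => ?_⟩
      convert Complex.abs_im_le_norm (∑ j, (v j : ℂ) * z a j) using 2
      simp [dotProduct, mul_comm]
    · refine ⟨fun j => (z a j).re, by linarith, fun v => ?_⟩
      convert Complex.abs_re_le_norm (∑ j, (v j : ℂ) * z a j) using 2
      simp [dotProduct, mul_comm]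
  choose Y hY1 hY2 using hy
  let e : (Fin k → ZMod p) ≃ Fin (p ^ k) := Fintype.equivFinOfCardEq (by simp [ZMod.card])
  refine ⟨p ^ k, pow_pos hp.pos k, ?_, fun i => Y (e.symm i), fun i => hY1 _, fun v => ?_⟩
  · rw [Nat.cast_pow, ← mul_pow]
    gcongr
    have h1 : p ≤ 2 * (k + 1) * d := by
      have : k ≤ k * d := Nat.le_mul_of_pos_right k (Nat.pos_of_ne_zero hd)
      linarith
    exact_mod_cast h1
  · rw [e.symm.sum_comp (fun a => (Y a ⬝ᵥ v) ^ (2 * k))]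
    have h := sum_norm_pow_moment_curve_le (p := p) (k := k) (d := d) (by omega) (by omega) v
    have hv : ∑ j, v j ^ 2 = v ⬝ᵥ v := by simp [dotProduct, sq]
    rw [hv] at h
    rw [Nat.cast_pow]
    refine le_trans (sum_le_sum fun a _ => ?_) h
    rw [← (even_two_mul k).pow_abs]
    exact pow_le_pow_left₀ (abs_nonneg _) (hY2 a v) _

end Construction

theorem sum_range_mul_mod (N m : ℕ) (f : ℕ → ℝ) :
    ∑ i ∈ range (N * m), f (i % N) = m * ∑ i ∈ range N, f i := by
  induction m with
  | zero => simp
  | succ m ih =>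
    rw [mul_add_one, sum_range_add, ih]
    have : ∑ x ∈ range N, f ((N * m + x) % N) = ∑ x ∈ range N, f x :=
      sum_congr rfl fun x hx => by rw [Nat.mul_add_mod, Nat.mod_eq_of_lt (mem_range.mp hx)]
    rw [this]
    push_cast
    ring

/-- Repeating `N` nonnegative terms periodically up to length `n`. -/
theorem sum_mod_le {N : ℕ} (hN : 0 < N) (n : ℕ) (f : Fin N → ℝ) (hf : ∀ i, 0 ≤ f i) :
    ∑ i : Fin n, f ⟨i % N, Nat.mod_lt _ hN⟩ ≤ ((n : ℝ) / N + 1) * ∑ i, f i := by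
  let g : ℕ → ℝ := fun i => f ⟨i % N, Nat.mod_lt _ hN⟩
  have hg (i : ℕ) : g (i % N) = g i := by simp [g]
  have hgf : ∑ i ∈ range N, g i = ∑ i, f i := by
    rw [← Fin.sum_univ_eq_sum_range]
    refine sum_congr rfl fun i _ => ?_
    simp [g, Nat.mod_eq_of_lt i.isLt]
  calc ∑ i : Fin n, f ⟨i % N, Nat.mod_lt _ hN⟩ = ∑ i ∈ range n, g i :=
        Fin.sum_univ_eq_sum_range g n
    -- Round up to whole periods.
    _ ≤ ∑ i ∈ range (N * (n / N + 1)), g i := by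
        refine sum_le_sum_of_subset_of_nonneg (range_subset_range.mpr ?_) fun i _ _ => hf _
        exact (Nat.lt_mul_div_succ n hN).le
    _ = ((n / N : ℕ) + 1) * ∑ i, f i := by
        rw [← hgf, ← Nat.cast_add_one, ← sum_range_mul_mod]
        simp only [hg]
    _ ≤ _ := by
        have : 0 ≤ ∑ i, f i := sum_nonneg fun i _ => hf i
        gcongr
        exact Nat.cast_div_le

theorem exists_matrix_large_specNorm {q : ℕ} (hq : q ≠ 0) (h4 : 4 ∣ q) {K : ℝ} (hK : 0 < K) :
    ∃ C : ℝ, 0 < C ∧ ∃ c : ℝ, 0 < c ∧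
      ∀ n d : ℕ, K * (d : ℝ) ^ ((q : ℝ) / 2) ≤ (n : ℝ) →
        ∃ X : Matrix (Fin n) (Fin d) ℝ,
          twoToExpNorm q X ≤ C ∧ c * (d : ℝ) ^ ((q : ℝ) / 4) ≤ specNorm (flatMoment q X) := by
  obtain ⟨m, rfl⟩ := h4
  have hm : m ≠ 0 := by
    rintro rfl
    exact hq rfl
  have hev : Even (4 * m) := ⟨2 * m, by ring⟩
  set k := 2 * m with hk
  have hq2 : 4 * m / 2 = k := by omega
  have hqk : 4 * m = 2 * k := by omega
  have hkpos : 0 < k := by omega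
  have hr2 : ((4 * m : ℕ) : ℝ) / 2 = k := by rw [hqk]; push_cast; ring
  have hr4 : ((4 * m : ℕ) : ℝ) / 4 = m := by push_cast; ring
  -- Rounding up to whole periods costs `n + N` in place of `n`, and `N ≤ n * ((2 * (k + 1)) ^ k /
  -- K)`; the factor `k ^ k` is the moment bound.
  set D : ℝ := (1 + (2 * (k + 1)) ^ k / K) * (k : ℝ) ^ k with hD
  have hDpos : 0 < D := by positivity
  refine ⟨D ^ (((4 * m : ℕ) : ℝ)⁻¹), by positivity, (1 / 4) ^ m, by positivity, fun n d hnd => ?_⟩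
  rw [hr2, Real.rpow_natCast] at hnd
  rw [hr4, Real.rpow_natCast, ← mul_pow]
  -- For `d = 0` the unit sphere is empty, so the supremum is `0`, and `0 ^ m = 0` since `m ≠ 0`.
  rcases eq_or_ne d 0 with rfl | hd
  · refine ⟨0, ?_, ?_⟩
    · refine Real.iSup_le (fun v => ?_) (by positivity)
      have := norm_eq_of_mem_sphere v
      rw [Subsingleton.elim (v : EuclideanSpace ℝ (Fin 0)) 0, norm_zero] at this
      exact absurd this zero_ne_one
    · simp [zero_pow hm, specNorm_nonneg]
  have hd' : 0 < (d : ℝ) := by positivity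
  have hn' : 0 < (n : ℝ) := lt_of_lt_of_le (by positivity) hnd
  have hn : n ≠ 0 := by
    rintro rfl
    simp at hn'
  obtain ⟨N, hN, hNle, y, hy, hmom⟩ := exists_rows_bounded_moment k hd
  have hN' : (0 : ℝ) < N := by exact_mod_cast hN
  refine ⟨fun i => y ⟨i % N, Nat.mod_lt _ hN⟩, ?_, ?_⟩
  · refine twoToExpNorm_le_of_sum_dotProduct_pow_le hq hev _ (by positivity) fun v => ?_
    rw [Real.rpow_inv_natCast_pow hDpos.le hq, hq2]
    have hvv : 0 ≤ (v ⬝ᵥ v) ^ k := pow_nonneg (sum_nonneg fun _ _ => mul_self_nonneg _) k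
    have hNn : (N : ℝ) ≤ n * ((2 * (k + 1)) ^ k / K) := by
      rw [mul_div_assoc', le_div_iff₀ hK]
      calc (N : ℝ) * K ≤ (2 * (k + 1)) ^ k * (d : ℝ) ^ k * K := by gcongr
        _ = (2 * (k + 1)) ^ k * (K * (d : ℝ) ^ k) := by ring
        _ ≤ (2 * (k + 1)) ^ k * n := by gcongr
        _ = _ := by ring
    calc ∑ i : Fin n, (y ⟨i % N, Nat.mod_lt _ hN⟩ ⬝ᵥ v) ^ (4 * m)
        ≤ ((n : ℝ) / N + 1) * ∑ i, (y i ⬝ᵥ v) ^ (4 * m) :=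
          sum_mod_le hN n (fun i => (y i ⬝ᵥ v) ^ (4 * m)) fun i => hev.pow_nonneg _
      _ ≤ ((n : ℝ) / N + 1) * (N * ((k : ℝ) ^ k * (v ⬝ᵥ v) ^ k)) := by
          gcongr
          rw [hqk]
          exact hmom v
      _ = (n + N) * ((k : ℝ) ^ k * (v ⬝ᵥ v) ^ k) := by field_simp
      _ ≤ (n + n * ((2 * (k + 1)) ^ k / K)) * ((k : ℝ) ^ k * (v ⬝ᵥ v) ^ k) := by gcongr
      _ = n * D * (v ⬝ᵥ v) ^ k := by rw [hD]; ring
  · have h := le_specNorm_flatMoment rfl hm hn hd (fun i => y ⟨i % N, Nat.mod_lt _ hN⟩)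
      fun i => hy _
    refine le_trans (le_of_eq ?_) h
    congr 1
    ring

theorem theoremB1 :
    -- the upper bound on the flattened spectral norm
    (∀ q : ℕ, 0 < q → Even q → ∀ (n d : ℕ) (α : ℝ), 0 < α →
      ∀ X : Matrix (Fin n) (Fin d) ℝ, twoToExpNorm q X ≤ α →
        specNorm (flatMoment q X) ≤ α ^ q * (d : ℝ) ^ ((q : ℝ) / 4)) ∧
    -- the baseline certificate is sound and has approximation factor `d ^ (1 / 4)`
    (∀ q : ℕ, 0 < q → Even q → ∀ n d : ℕ,
      (∀ X : Matrix (Fin n) (Fin d) ℝ,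
        twoToExpNorm q X ≤ baselineCert q X ∧
        baselineCert q X ≤ (d : ℝ) ^ ((1 : ℝ) / 4) * twoToExpNorm q X) ∧
      (∀ α : ℝ, 0 < α →
        SolvesApprox n d q α (α * (d : ℝ) ^ ((1 : ℝ) / 4))
          (fun X => α * (d : ℝ) ^ ((1 : ℝ) / 4) < baselineCert q X))) ∧
    -- tightness; `K` is the constant implicit in `n ≳ d ^ (q / 2)`
    (∀ q : ℕ, 0 < q → 4 ∣ q → ∀ K : ℝ, 0 < K →
      ∃ C : ℝ, 0 < C ∧ ∃ c : ℝ, 0 < c ∧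
        ∀ n d : ℕ, K * (d : ℝ) ^ ((q : ℝ) / 2) ≤ (n : ℝ) →
          ∃ X : Matrix (Fin n) (Fin d) ℝ,
            twoToExpNorm q X ≤ C ∧
            c * (d : ℝ) ^ ((q : ℝ) / 4) ≤ specNorm (flatMoment q X)) := by
  refine ⟨fun q hq hev n d α hα X hX => ?_, fun q hq hev n d => ⟨fun X => ?_, fun α hα X => ?_⟩,
    fun q hq h4 K hK => exists_matrix_large_specNorm hq.ne' h4 hK⟩
  · refine (specNorm_flatMoment_le hq.ne' hev X).trans ?_
    have := twoToExpNorm_nonneg (q := q) X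
    gcongr
  · exact ⟨twoToExpNorm_le_baselineCert hq.ne' hev X, baselineCert_le hq.ne' hev X⟩
  · refine ⟨fun h => h.trans_le (twoToExpNorm_le_baselineCert hq.ne' hev X), fun h => not_lt.mpr ?_⟩
    refine (baselineCert_le hq.ne' hev X).trans ?_
    rw [mul_comm]
    gcongr
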